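/- Theorem 3.1. For an integrable random variable $X$ let $\mu_k(X)=\mathbb E\max(X_1,\dots,X_k)$, where $X_1,\dots,X_k$ are independent copies of $X$. Let $\mathcal G^*$ be the set of all nonconstant functions $g:[1,\infty)\to\mathbb R$ for which there are a finite measure $\mu$ on $(0,\infty)$ and measurable functions $h\ge 0$ and $s$ on $(0,\infty)$ such that $$\int_{(0,\infty)}h(y)e^{-y}(1-e^{-y})\,d\mu(y)<\infty\quad\text{and}\quad g(x)=\int_{(0,\infty)}h(y)\bigl(s(y)-e^{-xy}\bigr)\,d\mu(y),\quad x\ge 1,$$ the last integrand being $\mu$-integrable. A Bernstein function is a continuous $B:[0,\infty)\to[0,\infty)$, infinitely differentiable on $(0,\infty)$, with $(-1)^{n+1}B^{(n)}(x)\ge 0$ for all $n\ge 1$ and $x>0$. It has Lévy–Khintchine triplet $(a_0,a_1;\nu)$ if $a_0,a_1\ge 0$, $\nu$ is a measure on $(0,\infty)$ with $\int_{(0,\infty)}\min\{1,y\}\,d\nu(y)<\infty$, and $B(x)=a_0+a_1x+\int_{(0,\infty)}(1-e^{-xy})\,d\nu(y)$ for all $x\ge 0$. For a real sequence $(\mu_k)_{k\ge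 1}$ the following are equivalent: (i) there is a non-degenerate (i.e. not almost surely constant) integrable random variable $X$ with $\mu_k(X)=\mu_k$ for all $k\ge 1$; (ii) there is $g\in\mathcal G^*$ with $\mu_k=g(k)$ for all $k\ge 1$; (iii) there is a Bernstein function $B$ with Lévy–Khintchine triplet $(0,0;\nu)$, $\nu\ne 0$, such that $\mu_k=\mu_1+B(k-1)$ for all $k\ge 1$. If one of (i), (ii), (iii) holds, then the function $g\in\mathcal G^*$ in (ii) and the Bernstein function $B$ in (iii) are unique, and $B(x)=g(x+1)-\mu_1$ for all $x\ge 0$. Moreover, let $X$ be any random variable as in (i), let $F$ be its distribution function, and put $\lambda=\mu_2-\mu_1$. Then $\lambda>0$, the function $f_V(x)=\frac1\lambda F(x)(1-F(x))$, $x\in\mathbb R$, is a probability density, and, if $V$ is a random variable with density $f_V$, the random variable $Y=-\log F(V)$ is almost surely positive and, with $F_Y$ its distribution function, $$g(x)=\int_{(0,\infty)}\frac{\lambda e^{y}}{1-e^{-y}}\left(\frac{\mu_1}{\lambda}e^{-y}(1-e^{-y})+e^{-y}-e^{-xy}\right)dF_Y(y),\qquad x\ge 1,$$ where the integrand is integrable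 with respect to $dF_Y$. -/

import Mathlib

open MeasureTheory ProbabilityTheory Set
open scoped ENNReal

universe u v

noncomputable section

/-- The expected maximum `E max(X₁, …, X_k)` of `k ≥ 1` independent copies of the random variable
`X` on the probability space `(Ω, P)`. The copies are the coordinates `X (ω i)` on the `k`-fold
product space. -/
def expectedMax {Ω : Type u} [MeasurableSpace Ω] (P : Measure Ω) (X : Ω → ℝ) (k : ℕ) : ℝ :=
  ∫ ω : Fin k → Ω, (⨆ i, X (ω i)) ∂(Measure.pi fun _ => P)

/-- `X` is an integrable, non-degenerate random variable on the probability space `(Ω, P)` whose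
expected maxima are the numbers `m k`, `k ≥ 1` (the value `m 0` plays no role). -/
structure HasExpectedMaxima {Ω : Type u} [MeasurableSpace Ω] (P : Measure Ω) (X : Ω → ℝ)
    (m : ℕ → ℝ) : Prop where
  integrable : Integrable X P
  nondegenerate : ¬ ∃ c : ℝ, ∀ᵐ ω ∂P, X ω = c
  expectedMax_eq : ∀ k : ℕ, 1 ≤ k → expectedMax P X k = m k

/-- `m 1, m 2, …` is the sequence of expected maxima of some integrable non-degenerate random
variable. -/
def IsExpectedMaximaSeq (m : ℕ → ℝ) : Prop :=
  ∃ (Ω : Type u) (_ : MeasurableSpace Ω) (P : Measure Ω) (_ : IsProbabilityMeasure P)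
    (X : Ω → ℝ), HasExpectedMaxima P X m

/-- `g` admits on `[1, ∞)` the generalized integral form
`g x = ∫_{(0,∞)} h y (s y - exp (-x y)) dμ(y)` with a finite measure `μ` on `(0, ∞)` and measurable
`h ≥ 0` and `s`, where `∫_{(0,∞)} h y exp (-y) (1 - exp (-y)) dμ(y) < ∞`. Measures on `(0, ∞)` are
represented as measures on `ℝ` giving no mass to `(-∞, 0]`. Only `g x` for `x ≥ 1` matters. -/
def HasGeneralizedIntegralForm (g : ℝ → ℝ) : Prop :=
  ∃ (μ : Measure ℝ) (h s : ℝ → ℝ),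
    IsFiniteMeasure μ ∧ μ (Iic 0) = 0 ∧ Measurable h ∧ Measurable s ∧
    (∀ y, 0 < y → 0 ≤ h y) ∧
    IntegrableOn (fun y => h y * Real.exp (-y) * (1 - Real.exp (-y))) (Ioi 0) μ ∧
    ∀ x : ℝ, 1 ≤ x →
      IntegrableOn (fun y => h y * (s y - Real.exp (-(x * y)))) (Ioi 0) μ ∧
      g x = ∫ y in Ioi 0, h y * (s y - Real.exp (-(x * y))) ∂μ

/-- The class `𝒢*`: functions on `[1, ∞)` which admit a generalized integral form and are not
constant on `[1, ∞)`. -/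
def GStar (g : ℝ → ℝ) : Prop :=
  HasGeneralizedIntegralForm g ∧ ¬ ∃ c : ℝ, ∀ x : ℝ, 1 ≤ x → g x = c

/-- `β : [0, ∞) → [0, ∞)` is a Bernstein function (only `β x` for `x ≥ 0` matters). -/
structure IsBernstein (β : ℝ → ℝ) : Prop where
  nonneg : ∀ x : ℝ, 0 ≤ x → 0 ≤ β x
  continuousOn : ContinuousOn β (Ici 0)
  contDiffOn : ContDiffOn ℝ ((⊤ : ℕ∞) : WithTop ℕ∞) β (Ioi 0)
  sign_deriv : ∀ n : ℕ, 1 ≤ n → ∀ x : ℝ, 0 < x → 0 ≤ (-1 : ℝ) ^ (n + 1) * iteratedDeriv n β x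

/-- `β` has the Lévy–Khintchine representation
`β x = a₀ + a₁ x + ∫_{(0,∞)} (1 - exp (-x y)) dν(y)`, `x ≥ 0`, with triplet `(a₀, a₁; ν)`. -/
structure HasLevyKhintchineTriplet (β : ℝ → ℝ) (a₀ a₁ : ℝ) (ν : Measure ℝ) : Prop where
  a₀_nonneg : 0 ≤ a₀
  a₁_nonneg : 0 ≤ a₁
  measure_Iic : ν (Iic 0) = 0
  lintegral_min_lt_top : ∫⁻ y in Ioi 0, ENNReal.ofReal (min 1 y) ∂ν < ∞
  eq_integral : ∀ x : ℝ, 0 ≤ x →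
    β x = a₀ + a₁ * x + ∫ y in Ioi 0, (1 - Real.exp (-(x * y))) ∂ν

/-- The class `ℬ*`: Bernstein functions with Lévy–Khintchine triplet `(0, 0; ν)`, `ν ≠ 0`. -/
def BStar (β : ℝ → ℝ) : Prop :=
  IsBernstein β ∧ ∃ ν : Measure ℝ, ν ≠ 0 ∧ HasLevyKhintchineTriplet β 0 0 ν

/-- The measure on `ℝ` with density `F x (1 - F x) / lam` with respect to Lebesgue measure. -/
def lawV (F : ℝ → ℝ) (lam : ℝ) : Measure ℝ :=
  volume.withDensity fun x => ENNReal.ofReal (1 / lam * (F x * (1 - F x)))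

end

/-!
Everything is expressed by the Laplace exponent `B x = ∫ (1 - e⁻ˣʸ) dν(y)` of a measure `ν` on
`(0, ∞)` with `∫ min (1, y) dν < ∞`.

*From random variables to functions.* Writing `x = ∫ (1_{t < x} - 1_{t < 0}) dt`, Fubini's theorem
gives `E max(X₁, …, X_k) - E X = ∫ (F - Fᵏ) dt`. The right-hand side is
`λ E[(1 - F(V)ᵏ⁻¹) / (1 - F(V))]`, where `V` has density `F (1 - F) / λ`, and in terms of
`Y = -log F(V)` this is a generalized integral form over the law of `Y`
(`HasExpectedMaxima.representation`, `HasExpectedMaxima.gStar`). The constant `λ` is positive, since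
otherwise `F` takes the values `0` and `1` only.

*From generalized integral forms to Bernstein functions.* If `g x = ∫ h y (s y - e⁻ˣʸ) dμ(y)`, then
`g (x + 1) - g 1` is the Laplace exponent of `h y e⁻ʸ dμ(y)` (`GStar.bStar`); that it is a Bernstein
function is differentiation under the integral sign (`isBernstein_of_eqOn`).

*From Bernstein functions to random variables.* The image of `eʸ dν(y)` under `y ↦ e⁻ʸ` is a measure
`ρ` on `(0, 1)` with `∫ v (1 - v) dρ(v) < ∞`. The function
`Q u = c + ∫ (1_{v < u} - 1_{v < 1/2}) dρ(v)` is increasing, and if `U` is uniform on `(0, 1)`, then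
the maximum of copies of `Q(U)` is `Q` at the maximum of copies of `U`. The same Fubini argument as
above (`expectedMax_eq_integral` serves both) gives `E max(X₁, …, X_k) - E X = ∫ (v - vᵏ) dρ(v)` for
`X = Q(U)`, which equals `B (k - 1)` (`isExpectedMaximaSeq_of_laplaceExponent`).

*Uniqueness.* The increments `B (n + 1) - B n` are the moments of `u = e⁻ʸ` under the finite measure
`(1 - e⁻ʸ) dν(y)`. By the Weierstrass approximation theorem they determine the integral of the
continuous function `(1 - uˣ) / (1 - u)` on `[0, 1]`, which is `B x` (`eqOn_laplaceExponent`).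
-/

open Filter Topology

/-! ### Laplace exponents -/

/-- The Laplace exponent `x ↦ ∫_{(0,∞)} (1 - exp (-x y)) dν(y)` of a measure `ν` on `(0, ∞)`. -/
noncomputable def laplaceExponent (ν : Measure ℝ) (x : ℝ) : ℝ :=
  ∫ y in Ioi 0, (1 - Real.exp (-(x * y))) ∂ν

lemma integrableOn_min_iff (ν : Measure ℝ) :
    IntegrableOn (fun y : ℝ => min 1 y) (Ioi 0) ν ↔
      ∫⁻ y in Ioi 0, ENNReal.ofReal (min 1 y) ∂ν < ∞ := by
  rw [IntegrableOn, Integrable, hasFiniteIntegral_iff_ofReal]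
  · simp only [and_iff_right_iff_imp]
    intro _
    fun_prop
  · filter_upwards [ae_restrict_mem measurableSet_Ioi] with y hy
    exact le_min zero_le_one (le_of_lt hy)

lemma one_sub_exp_neg_le {x y : ℝ} (hx : 0 ≤ x) (hy : 0 < y) :
    1 - Real.exp (-(x * y)) ≤ (1 + x) * min 1 y := by
  rcases le_total 1 y with h | h
  · rw [min_eq_left h]
    have := Real.exp_pos (-(x * y))
    linarith
  · rw [min_eq_right h]
    have := Real.add_one_le_exp (-(x * y))
    nlinarith

lemma one_sub_exp_neg_nonneg {x y : ℝ} (hx : 0 ≤ x) (hy : 0 < y) :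
    0 ≤ 1 - Real.exp (-(x * y)) := by
  have : Real.exp (-(x * y)) ≤ 1 := Real.exp_le_one_iff.2 (by nlinarith)
  linarith

lemma one_sub_exp_neg_pos {y : ℝ} (hy : 0 < y) : 0 < 1 - Real.exp (-y) := by
  have : Real.exp (-y) < 1 := by simpa using hy
  linarith

lemma min_one_le_mul_one_sub_exp {y : ℝ} (hy : 0 < y) :
    min 1 y ≤ 2 * (1 - Real.exp (-y)) := by
  -- `1 - exp (-y) ≥ y / (1 + y)`
  have h1 : Real.exp (-y) * (1 + y) ≤ 1 := by
    have := Real.add_one_le_exp y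
    calc Real.exp (-y) * (1 + y) ≤ Real.exp (-y) * Real.exp y := by
          gcongr; linarith
      _ = 1 := by rw [← Real.exp_add]; simp
  have h0 := Real.exp_pos (-y)
  rcases le_total 1 y with h | h
  · rw [min_eq_left h]
    nlinarith
  · rw [min_eq_right h]
    nlinarith

lemma integrableOn_one_sub_exp {ν : Measure ℝ}
    (hν : IntegrableOn (fun y : ℝ => min 1 y) (Ioi 0) ν) {x : ℝ} (hx : 0 ≤ x) :
    IntegrableOn (fun y => 1 - Real.exp (-(x * y))) (Ioi 0) ν := by
  refine Integrable.mono' (hν.const_mul (1 + x)) (by fun_prop) ?_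
  filter_upwards [ae_restrict_mem measurableSet_Ioi] with y hy
  rw [Real.norm_of_nonneg (one_sub_exp_neg_nonneg hx hy)]
  exact one_sub_exp_neg_le hx hy

/-- Since `yⁿ⁺¹ exp (-ε y)` is bounded and `O(y)` at `0`, it is integrable against every Lévy
measure. -/
lemma integrableOn_pow_mul_exp {ν : Measure ℝ}
    (hν : IntegrableOn (fun y : ℝ => min 1 y) (Ioi 0) ν) (n : ℕ) {ε : ℝ} (hε : 0 < ε) :
    IntegrableOn (fun y => y ^ (n + 1) * Real.exp (-(ε * y))) (Ioi 0) ν := by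
  have key : ∀ (n : ℕ) (y : ℝ), 0 < y →
      y ^ n * Real.exp (-(ε * y)) ≤ n.factorial / ε ^ n := by
    intro n y hy
    have h := Real.pow_div_factorial_le_exp _ (mul_pos hε hy).le n
    rw [div_le_iff₀ (by positivity), mul_pow] at h
    rw [le_div_iff₀ (by positivity), Real.exp_neg, ← div_eq_mul_inv, div_mul_eq_mul_div,
      div_le_iff₀ (Real.exp_pos _)]
    linarith
  set C := max ((n + 1).factorial / ε ^ (n + 1)) (n.factorial / ε ^ n) with hC
  refine Integrable.mono' (hν.const_mul C) (by fun_prop) ?_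
  filter_upwards [ae_restrict_mem measurableSet_Ioi] with y (hy : 0 < y)
  rw [Real.norm_of_nonneg (by positivity)]
  rcases le_total 1 y with h | h
  · rw [min_eq_left h, mul_one]
    exact (key (n + 1) y hy).trans (le_max_left _ _)
  · rw [min_eq_right h]
    calc y ^ (n + 1) * Real.exp (-(ε * y)) = (y ^ n * Real.exp (-(ε * y))) * y := by ring
      _ ≤ C * y := by
        gcongr
        exact (key n y hy).trans (le_max_right _ _)

lemma hasDerivAt_laplaceExponent {ν : Measure ℝ}
    (hν : IntegrableOn (fun y : ℝ => min 1 y) (Ioi 0) ν) {x : ℝ} (hx : 0 < x) :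
    HasDerivAt (laplaceExponent ν) (∫ y in Ioi 0, y ^ (0 + 1) * Real.exp (-(x * y)) ∂ν) x := by
  refine (hasDerivAt_integral_of_dominated_loc_of_deriv_le
    (F := fun x y => 1 - Real.exp (-(x * y)))
    (F' := fun x y => y ^ (0 + 1) * Real.exp (-(x * y)))
    (bound := fun y => y ^ (0 + 1) * Real.exp (-(x / 2 * y)))
    (Ioi_mem_nhds (half_lt_self hx)) (.of_forall fun _ => by fun_prop)
    (integrableOn_one_sub_exp hν hx.le) (by fun_prop) ?_
    (integrableOn_pow_mul_exp hν 0 (half_pos hx)) ?_).2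
  · filter_upwards [ae_restrict_mem measurableSet_Ioi] with y (hy : 0 < y) z (hz : x / 2 < z)
    rw [Real.norm_of_nonneg (by positivity)]
    gcongr
  · refine .of_forall fun y z _ => ?_
    have := (((hasDerivAt_id z).mul_const y).neg.exp).const_sub 1
    refine this.congr_deriv ?_
    simp; ring

lemma hasDerivAt_integral_pow_mul_exp {ν : Measure ℝ}
    (hν : IntegrableOn (fun y : ℝ => min 1 y) (Ioi 0) ν) (n : ℕ) {x : ℝ} (hx : 0 < x) :
    HasDerivAt (fun x => ∫ y in Ioi 0, y ^ (n + 1) * Real.exp (-(x * y)) ∂ν)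
      (-∫ y in Ioi 0, y ^ (n + 1 + 1) * Real.exp (-(x * y)) ∂ν) x := by
  rw [← integral_neg]
  refine (hasDerivAt_integral_of_dominated_loc_of_deriv_le
    (F := fun x y => y ^ (n + 1) * Real.exp (-(x * y)))
    (F' := fun x y => -(y ^ (n + 1 + 1) * Real.exp (-(x * y))))
    (bound := fun y => y ^ (n + 1 + 1) * Real.exp (-(x / 2 * y)))
    (Ioi_mem_nhds (half_lt_self hx)) (.of_forall fun _ => by fun_prop)
    (integrableOn_pow_mul_exp hν n hx) (by fun_prop) ?_
    (integrableOn_pow_mul_exp hν (n + 1) (half_pos hx)) ?_).2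
  · filter_upwards [ae_restrict_mem measurableSet_Ioi] with y (hy : 0 < y) z (hz : x / 2 < z)
    rw [norm_neg, Real.norm_of_nonneg (by positivity)]
    gcongr
  · refine .of_forall fun y z _ => ?_
    have := (((hasDerivAt_id z).mul_const y).neg.exp).const_mul (y ^ (n + 1))
    refine this.congr_deriv ?_
    simp; ring

lemma contDiffOn_integral_pow_mul_exp {ν : Measure ℝ}
    (hν : IntegrableOn (fun y : ℝ => min 1 y) (Ioi 0) ν) (k : ℕ) : ∀ n : ℕ,
    ContDiffOn ℝ k (fun x => ∫ y in Ioi 0, y ^ (n + 1) * Real.exp (-(x * y)) ∂ν) (Ioi 0) := by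
  induction k with
  | zero =>
    intro n
    refine contDiffOn_zero.2 fun x hx => ?_
    exact (hasDerivAt_integral_pow_mul_exp hν n hx).continuousAt.continuousWithinAt
  | succ k ih =>
    intro n
    rw [Nat.cast_succ, contDiffOn_succ_iff_deriv_of_isOpen isOpen_Ioi]
    refine ⟨fun x hx => (hasDerivAt_integral_pow_mul_exp hν n
      hx).differentiableAt.differentiableWithinAt, by simp, ?_⟩
    exact (ih (n + 1)).neg.congr fun x hx => (hasDerivAt_integral_pow_mul_exp hν n hx).deriv

lemma contDiffOn_laplaceExponent {ν : Measure ℝ}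
    (hν : IntegrableOn (fun y : ℝ => min 1 y) (Ioi 0) ν) :
    ContDiffOn ℝ ((⊤ : ℕ∞) : WithTop ℕ∞) (laplaceExponent ν) (Ioi 0) := by
  rw [contDiffOn_infty_iff_deriv_of_isOpen isOpen_Ioi]
  refine ⟨fun x hx => (hasDerivAt_laplaceExponent hν hx).differentiableAt.differentiableWithinAt,
    contDiffOn_infty.2 fun k => ?_⟩
  exact (contDiffOn_integral_pow_mul_exp hν k 0).congr fun x hx =>
    (hasDerivAt_laplaceExponent hν hx).deriv

lemma iteratedDeriv_laplaceExponent {ν : Measure ℝ}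
    (hν : IntegrableOn (fun y : ℝ => min 1 y) (Ioi 0) ν) (n : ℕ) {x : ℝ} (hx : 0 < x) :
    iteratedDeriv (n + 1) (laplaceExponent ν) x =
      (-1) ^ n * ∫ y in Ioi 0, y ^ (n + 1) * Real.exp (-(x * y)) ∂ν := by
  induction n generalizing x with
  | zero => simp [(hasDerivAt_laplaceExponent hν hx).deriv]
  | succ n ih =>
    rw [iteratedDeriv_succ]
    have : iteratedDeriv (n + 1) (laplaceExponent ν) =ᶠ[𝓝 x]
        fun x => (-1) ^ n * ∫ y in Ioi 0, y ^ (n + 1) * Real.exp (-(x * y)) ∂ν := by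
      filter_upwards [Ioi_mem_nhds hx] with z hz using ih hz
    rw [this.deriv_eq, ((hasDerivAt_integral_pow_mul_exp hν n hx).const_mul _).deriv]
    ring

lemma continuousOn_laplaceExponent {ν : Measure ℝ}
    (hν : IntegrableOn (fun y : ℝ => min 1 y) (Ioi 0) ν) :
    ContinuousOn (laplaceExponent ν) (Ici 0) := by
  intro x _
  refine continuousWithinAt_of_dominated (bound := fun y => (1 + (x + 1)) * min 1 y)
    (.of_forall fun _ => by fun_prop) ?_ (hν.const_mul _)
    (.of_forall fun y => by fun_prop)
  filter_upwards [self_mem_nhdsWithin, mem_nhdsWithin_of_mem_nhds (Iio_mem_nhds (lt_add_one x))]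
    with z (hz : 0 ≤ z) (hz' : z < x + 1)
  filter_upwards [ae_restrict_mem measurableSet_Ioi] with y (hy : 0 < y)
  rw [Real.norm_of_nonneg (one_sub_exp_neg_nonneg hz hy)]
  refine (one_sub_exp_neg_le hz hy).trans ?_
  gcongr

/-- A function which is on `[0, ∞)` the Laplace exponent of a Lévy measure is a Bernstein
function. -/
lemma isBernstein_of_eqOn {ν : Measure ℝ} (hν : IntegrableOn (fun y : ℝ => min 1 y) (Ioi 0) ν)
    {β : ℝ → ℝ} (hβ : EqOn β (laplaceExponent ν) (Ici 0)) : IsBernstein β where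
  nonneg x hx := by
    rw [hβ hx]
    exact setIntegral_nonneg measurableSet_Ioi fun y hy => one_sub_exp_neg_nonneg hx hy
  continuousOn := (continuousOn_laplaceExponent hν).congr hβ
  contDiffOn := (contDiffOn_laplaceExponent hν).congr (hβ.mono Ioi_subset_Ici_self)
  sign_deriv n hn x hx := by
    obtain ⟨n, rfl⟩ := Nat.exists_eq_add_of_le' hn
    have : β =ᶠ[𝓝 x] laplaceExponent ν := by
      filter_upwards [Ioi_mem_nhds hx] with z (hz : 0 < z) using hβ hz.le
    rw [this.iteratedDeriv_eq, iteratedDeriv_laplaceExponent hν n hx, ← mul_assoc, ← pow_add,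
      Even.neg_one_pow ⟨n + 1, by ring⟩, one_mul]
    exact setIntegral_nonneg measurableSet_Ioi fun y (hy : 0 < y) => by positivity

lemma bStar_iff {β : ℝ → ℝ} : BStar β ↔ ∃ ν : Measure ℝ, ν ≠ 0 ∧ ν (Iic 0) = 0 ∧
    IntegrableOn (fun y : ℝ => min 1 y) (Ioi 0) ν ∧ EqOn β (laplaceExponent ν) (Ici 0) := by
  constructor
  · rintro ⟨_, ν, h0, h⟩
    refine ⟨ν, h0, h.measure_Iic, (integrableOn_min_iff ν).2 h.lintegral_min_lt_top,
      fun x hx => ?_⟩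
    simpa [laplaceExponent] using h.eq_integral x hx
  · rintro ⟨ν, h0, hI, hν, hβ⟩
    exact ⟨isBernstein_of_eqOn hν hβ, ν, h0, le_rfl, le_rfl, hI, (integrableOn_min_iff ν).1 hν,
      fun x hx => by simpa [laplaceExponent] using hβ hx⟩

lemma laplaceExponent_one_pos {ν : Measure ℝ} (h0 : ν ≠ 0) (hI : ν (Iic 0) = 0)
    (hν : IntegrableOn (fun y : ℝ => min 1 y) (Ioi 0) ν) : 0 < laplaceExponent ν 1 := by
  have hnn : ∀ y ∈ Ioi (0 : ℝ), 0 ≤ 1 - Real.exp (-(1 * y)) := fun y hy =>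
    one_sub_exp_neg_nonneg zero_le_one hy
  refine (setIntegral_pos_iff_support_of_nonneg_ae
    ((ae_restrict_mem measurableSet_Ioi).mono hnn)
    (integrableOn_one_sub_exp hν zero_le_one)).2 ?_
  have hs : Function.support (fun y => 1 - Real.exp (-(1 * y))) ∩ Ioi 0 = Ioi 0 :=
    inter_eq_right.2 fun y hy => by
      simpa using (one_sub_exp_neg_pos hy).ne'
  rw [hs, pos_iff_ne_zero]
  refine fun h => h0 (Measure.measure_univ_eq_zero.1 ?_)
  rw [← Iic_union_Ioi (a := (0 : ℝ))]
  exact measure_union_null hI h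

/-! ### Determination of a Laplace exponent by its values at the integers -/

/-- The Hausdorff moments `∫ e^{-ny} (1 - e^{-y}) dν(y)` of a Lévy measure are the increments of
its Laplace exponent. -/
lemma integral_exp_pow_mul {ν : Measure ℝ}
    (hν : IntegrableOn (fun y : ℝ => min 1 y) (Ioi 0) ν) (n : ℕ) :
    ∫ y in Ioi 0, Real.exp (-y) ^ n * (1 - Real.exp (-y)) ∂ν =
      laplaceExponent ν (n + 1) - laplaceExponent ν n := by
  rw [laplaceExponent, laplaceExponent, ← integral_sub
    (integrableOn_one_sub_exp hν (by positivity)) (integrableOn_one_sub_exp hν (by positivity))]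
  congr 1 with y
  rw [← Real.exp_nat_mul, show -((n + 1 : ℝ) * y) = n * -y + -y by ring, Real.exp_add,
    show -((n : ℝ) * y) = n * -y by ring]
  ring

lemma integrableOn_comp_exp_mul {ν : Measure ℝ}
    (hν : IntegrableOn (fun y : ℝ => min 1 y) (Ioi 0) ν) {f : ℝ → ℝ}
    (hf : ContinuousOn f (Icc 0 1)) :
    IntegrableOn (fun y => f (Real.exp (-y)) * (1 - Real.exp (-y))) (Ioi 0) ν := by
  obtain ⟨C, hC⟩ := isCompact_Icc.exists_bound_of_continuousOn hf
  have hmem : ∀ y ∈ Ioi (0 : ℝ), Real.exp (-y) ∈ Icc (0 : ℝ) 1 := fun y (hy : 0 < y) =>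
    ⟨(Real.exp_pos _).le, Real.exp_le_one_iff.2 (by linarith)⟩
  have hI : IntegrableOn (fun y => 1 - Real.exp (-y)) (Ioi 0) ν := by
    simpa using integrableOn_one_sub_exp hν zero_le_one
  refine Integrable.mono' (hI.const_mul C) ?_ ?_
  · refine ContinuousOn.aestronglyMeasurable ?_ measurableSet_Ioi
    exact (hf.comp (by fun_prop) hmem).mul (by fun_prop)
  · filter_upwards [ae_restrict_mem measurableSet_Ioi] with y hy
    rw [norm_mul, Real.norm_of_nonneg (one_sub_exp_neg_pos hy).le]
    gcongr
    · exact (one_sub_exp_neg_pos hy).le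
    · exact hC _ (hmem y hy)

/-- By the Weierstrass approximation theorem the Hausdorff moments determine the integrals of all
continuous functions of `e^{-y}`. -/
lemma integral_comp_exp_mul_eq {ν ν' : Measure ℝ}
    (hν : IntegrableOn (fun y : ℝ => min 1 y) (Ioi 0) ν)
    (hν' : IntegrableOn (fun y : ℝ => min 1 y) (Ioi 0) ν')
    (h : ∀ n : ℕ, laplaceExponent ν n = laplaceExponent ν' n) {f : ℝ → ℝ}
    (hf : ContinuousOn f (Icc 0 1)) :
    ∫ y in Ioi 0, f (Real.exp (-y)) * (1 - Real.exp (-y)) ∂ν =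
      ∫ y in Ioi 0, f (Real.exp (-y)) * (1 - Real.exp (-y)) ∂ν' := by
  have hpoly : ∀ p : Polynomial ℝ,
      ∫ y in Ioi 0, p.eval (Real.exp (-y)) * (1 - Real.exp (-y)) ∂ν =
        ∫ y in Ioi 0, p.eval (Real.exp (-y)) * (1 - Real.exp (-y)) ∂ν' := by
    intro p
    induction p using Polynomial.induction_on' with
    | add p q hp hq =>
      simp only [Polynomial.eval_add, add_mul]
      rw [integral_add (integrableOn_comp_exp_mul hν p.continuousOn)
        (integrableOn_comp_exp_mul hν q.continuousOn), hp, hq,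
        integral_add (integrableOn_comp_exp_mul hν' p.continuousOn)
        (integrableOn_comp_exp_mul hν' q.continuousOn)]
    | monomial n a =>
      simp only [Polynomial.eval_monomial, mul_assoc]
      rw [integral_const_mul, integral_const_mul, integral_exp_pow_mul hν,
        integral_exp_pow_mul hν', h, ← Nat.cast_succ, h]
  have happrox : ∀ {ν : Measure ℝ}, IntegrableOn (fun y : ℝ => min 1 y) (Ioi 0) ν →
      ∀ (p : Polynomial ℝ) (ε : ℝ), (∀ u ∈ Icc (0 : ℝ) 1, |p.eval u - f u| < ε) →
      |∫ y in Ioi 0, p.eval (Real.exp (-y)) * (1 - Real.exp (-y)) ∂ν -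
        ∫ y in Ioi 0, f (Real.exp (-y)) * (1 - Real.exp (-y)) ∂ν| ≤
          ε * laplaceExponent ν 1 := by
    intro ν hν p ε hp
    rw [← integral_sub (integrableOn_comp_exp_mul hν p.continuousOn)
      (integrableOn_comp_exp_mul hν hf), laplaceExponent, ← integral_const_mul,
      ← Real.norm_eq_abs]
    refine norm_integral_le_of_norm_le
      ((integrableOn_one_sub_exp hν zero_le_one).const_mul ε) ?_
    filter_upwards [ae_restrict_mem measurableSet_Ioi] with y (hy : 0 < y)
    rw [← sub_mul, norm_mul, one_mul, Real.norm_of_nonneg (one_sub_exp_neg_pos hy).le,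
      Real.norm_eq_abs]
    gcongr
    · exact (one_sub_exp_neg_pos hy).le
    · exact (hp _ ⟨(Real.exp_pos _).le, Real.exp_le_one_iff.2 (by linarith)⟩).le
  refine eq_of_abs_sub_nonpos (le_of_forall_pos_le_add fun δ hδ => ?_)
  have hL : laplaceExponent ν' 1 = laplaceExponent ν 1 := by simpa using (h 1).symm
  have hL0 : 0 ≤ laplaceExponent ν 1 :=
    setIntegral_nonneg measurableSet_Ioi fun y hy => one_sub_exp_neg_nonneg zero_le_one hy
  obtain ⟨p, hp⟩ := exists_polynomial_near_of_continuousOn 0 1 f hf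
    (δ / (2 * (laplaceExponent ν 1 + 1))) (by positivity)
  have h1 := abs_le.1 (happrox hν p _ hp)
  have h2 := abs_le.1 (happrox hν' p _ hp)
  rw [hpoly p] at h1
  rw [hL] at h2
  have h3 : δ / (2 * (laplaceExponent ν 1 + 1)) * laplaceExponent ν 1 ≤ δ / 2 := by
    rw [div_mul_eq_mul_div, div_le_div_iff₀ (by positivity) (by positivity)]
    nlinarith
  rw [abs_le]
  constructor <;> linarith [h1.1, h1.2, h2.1, h2.2]

/-- A Laplace exponent is determined by its values at the integers: `B x` is the integral against
`(1 - e^{-y}) dν(y)` of `(1 - uˣ) / (1 - u)`, `u = e^{-y}`, which extends continuously to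
`u ∈ [0, 1]`. -/
lemma eqOn_laplaceExponent {ν ν' : Measure ℝ}
    (hν : IntegrableOn (fun y : ℝ => min 1 y) (Ioi 0) ν)
    (hν' : IntegrableOn (fun y : ℝ => min 1 y) (Ioi 0) ν')
    (h : ∀ n : ℕ, laplaceExponent ν n = laplaceExponent ν' n) :
    EqOn (laplaceExponent ν) (laplaceExponent ν') (Ici 0) := by
  intro x (hx : 0 ≤ x)
  have hcont : ContinuousOn (dslope (fun u : ℝ => u ^ x) 1) (Icc 0 1) := by
    refine ContinuousOn.mono ((continuousOn_dslope (Ici_mem_nhds zero_lt_one)).2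
      ⟨(Real.continuous_rpow_const hx).continuousOn, ?_⟩) Icc_subset_Ici_self
    exact Real.differentiableAt_rpow_const_of_ne x one_ne_zero
  have key : ∀ y ∈ Ioi (0 : ℝ), 1 - Real.exp (-(x * y)) =
      dslope (fun u : ℝ => u ^ x) 1 (Real.exp (-y)) * (1 - Real.exp (-y)) := by
    intro y hy
    have h0 := one_sub_exp_neg_pos hy
    have h1 : Real.exp (-y) - 1 ≠ 0 := by linarith
    rw [dslope_of_ne _ (by intro h; rw [h] at h0; simp at h0), slope_def_field, Real.one_rpow,
      ← Real.exp_mul, show -y * x = -(x * y) by ring]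
    field_simp
    ring
  rw [laplaceExponent, laplaceExponent, setIntegral_congr_fun measurableSet_Ioi key,
    setIntegral_congr_fun measurableSet_Ioi key]
  exact integral_comp_exp_mul_eq hν hν' h hcont

lemma BStar.eqOn {β β' : ℝ → ℝ} (h : BStar β) (h' : BStar β') (heq : ∀ n : ℕ, β n = β' n) :
    EqOn β β' (Ici 0) := by
  obtain ⟨ν, -, -, hν, hβ⟩ := bStar_iff.1 h
  obtain ⟨ν', -, -, hν', hβ'⟩ := bStar_iff.1 h'
  have : EqOn (laplaceExponent ν) (laplaceExponent ν') (Ici 0) :=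
    eqOn_laplaceExponent hν hν' fun n => by
      rw [← hβ (Nat.cast_nonneg (α := ℝ) n), ← hβ' (Nat.cast_nonneg (α := ℝ) n), heq]
  exact hβ.trans (this.trans hβ'.symm)

/-! ### Expected maxima as integrals -/

lemma ciSup_eq_apply {ι : Type*} [Finite ι] [Nonempty ι] (x : ι → ℝ) :
    ∃ i, x i = ⨆ j, x j ∧ ∀ j, x j ≤ x i := by
  obtain ⟨i, hi⟩ := exists_eq_ciSup_of_finite (f := x)
  exact ⟨i, hi, fun j => hi ▸ le_ciSup (finite_range x).bddAbove j⟩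

/-- Expected maxima depend on the law of the random variable only. -/
lemma expectedMax_eq_map {Ω : Type*} [MeasurableSpace Ω] (P : Measure Ω) [IsProbabilityMeasure P]
    {X : Ω → ℝ} (hX : AEMeasurable X P) (k : ℕ) :
    expectedMax P X k = expectedMax (P.map X) id k := by
  have : IsProbabilityMeasure (P.map X) := Measure.isProbabilityMeasure_map hX
  have hmeas : Measurable fun x : Fin k → ℝ => ⨆ i, x i := .iSup fun i => measurable_pi_apply i
  unfold expectedMax
  simp only [id_eq]
  rw [← Measure.pi_map_pi fun _ => hX, integral_map _ hmeas.aestronglyMeasurable]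
  exact aemeasurable_pi_lambda _ fun i =>
    hX.comp_quasiMeasurePreserving (Measure.quasiMeasurePreserving_eval _ i)

/-- The function `t ↦ 1_{t < z} - 1_{t < a}`, i.e. the signed indicator function of the interval
between `a` and `z`. -/
noncomputable def signedStep (a z t : ℝ) : ℝ := (if t < z then 1 else 0) - if t < a then 1 else 0

lemma signedStep_mono {a z z' : ℝ} (h : z ≤ z') (t : ℝ) :
    signedStep a z t ≤ signedStep a z' t := by
  unfold signedStep
  gcongr
  split_ifs <;> linarith

lemma measurable_signedStep {α : Type*} [MeasurableSpace α] {a : ℝ} {z t : α → ℝ}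
    (hz : Measurable z) (ht : Measurable t) : Measurable fun x => signedStep a (z x) (t x) := by
  unfold signedStep
  exact (Measurable.ite (measurableSet_lt ht hz) measurable_const measurable_const).sub
    (Measurable.ite (measurableSet_lt ht measurable_const) measurable_const measurable_const)

section

variable {S : Type*} [MeasurableSpace S] {ρ : Measure S} [SFinite ρ] {θ : S → ℝ}
  {τ : Measure ℝ} [IsProbabilityMeasure τ] {a : ℝ}

lemma integrable_signedStep_iSup (hθ : Measurable θ)
    (hint : Integrable (fun p : ℝ × S => signedStep a p.1 (θ p.2)) (τ.prod ρ))
    (k : ℕ) [NeZero k] :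
    Integrable (fun p : (Fin k → ℝ) × S => signedStep a (⨆ i, p.1 i) (θ p.2))
      ((Measure.pi fun _ => τ).prod ρ) := by
  have hsum : Integrable (fun p : (Fin k → ℝ) × S => ∑ i, ‖signedStep a (p.1 i) (θ p.2)‖)
      ((Measure.pi fun _ => τ).prod ρ) := by
    refine integrable_finsetSum _ fun i _ => ?_
    exact (((measurePreserving_eval (fun _ : Fin k => τ) i).prod
      (MeasurePreserving.id ρ)).integrable_comp_of_integrable hint).norm
  refine hsum.mono' (measurable_signedStep ?_ (hθ.comp measurable_snd)).aestronglyMeasurable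
    (.of_forall fun p => ?_)
  · exact .iSup fun i => (measurable_pi_apply i).comp measurable_fst
  · obtain ⟨i, hi, -⟩ := ciSup_eq_apply p.1
    rw [← hi]
    exact Finset.single_le_sum (f := fun i => ‖signedStep a (p.1 i) (θ p.2)‖)
      (fun _ _ => norm_nonneg _) (Finset.mem_univ i)

lemma integral_signedStep_iSup (k : ℕ) [NeZero k] (t : ℝ) :
    ∫ x : Fin k → ℝ, signedStep a (⨆ i, x i) t ∂(Measure.pi fun _ => τ) =
      (if t < a then 0 else 1) - τ.real (Iic t) ^ k := by
  have hset : ∀ x : Fin k → ℝ, signedStep a (⨆ i, x i) t =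
      (if t < a then 0 else 1) - (univ.pi fun _ : Fin k => Iic t).indicator 1 x := by
    intro x
    have : x ∈ (univ.pi fun _ : Fin k => Iic t) ↔ ¬ t < ⨆ i, x i := by
      obtain ⟨i, hi, hle⟩ := ciSup_eq_apply x
      rw [← hi, not_lt]
      exact ⟨fun h => h i (mem_univ i), fun h j _ => (hle j).trans h⟩
    by_cases h : t < ⨆ i, x i
    · rw [indicator_of_notMem (by rw [this]; exact not_not.2 h)]
      simp only [signedStep, h]
      split_ifs <;> norm_num
    · rw [indicator_of_mem (this.2 h)]
      simp only [signedStep, h, if_false, Pi.one_apply]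
      split_ifs <;> norm_num
  have hms : MeasurableSet (univ.pi fun _ : Fin k => Iic t) :=
    .univ_pi fun _ => measurableSet_Iic
  simp_rw [hset]
  have hind : Integrable ((univ.pi fun _ : Fin k => Iic t).indicator (1 : (Fin k → ℝ) → ℝ))
      (Measure.pi fun _ => τ) := (integrable_const (1 : ℝ)).indicator hms
  rw [integral_sub (integrable_const _) hind, integral_indicator_one hms]
  rw [measureReal_def, Measure.pi_pi]
  simp [measureReal_def]

/-- If `Q` is the quantile-like transform `Q z = c + ∫ (1_{θ < z} - 1_{θ < a}) dρ`, then `Q` is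
increasing, so the maximum of `Q` at several independent points with law `τ` is `Q` at their
maximum; Fubini's theorem expresses its expectation by the distribution function of `τ`. -/
lemma expectedMax_eq_integral (hθ : Measurable θ)
    (hint : Integrable (fun p : ℝ × S => signedStep a p.1 (θ p.2)) (τ.prod ρ))
    {Q : ℝ → ℝ} {c : ℝ} (hQ : ∀ᵐ z ∂τ, Q z = c + ∫ s, signedStep a z (θ s) ∂ρ)
    (k : ℕ) [NeZero k] :
    Integrable (fun s => (if θ s < a then 0 else 1) - τ.real (Iic (θ s)) ^ k) ρ ∧
    expectedMax τ Q k = c + ∫ s, ((if θ s < a then 0 else 1) - τ.real (Iic (θ s)) ^ k) ∂ρ := by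
  have hI := integrable_signedStep_iSup hθ hint k
  constructor
  · refine hI.integral_prod_right.congr (.of_forall fun s => ?_)
    exact integral_signedStep_iSup k (θ s)
  have hsup : ∀ᵐ x : Fin k → ℝ ∂(Measure.pi fun _ => τ), (⨆ i, Q (x i)) =
      c + ∫ s, signedStep a (⨆ i, x i) (θ s) ∂ρ := by
    have hgood : ∀ᵐ x : Fin k → ℝ ∂(Measure.pi fun _ => τ), ∀ i,
        Q (x i) = c + ∫ s, signedStep a (x i) (θ s) ∂ρ ∧
        Integrable (fun s => signedStep a (x i) (θ s)) ρ := by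
      rw [ae_all_iff]
      intro i
      exact (Measure.quasiMeasurePreserving_eval (fun _ : Fin k => τ) i).ae
        (hQ.and hint.prod_right_ae)
    filter_upwards [hgood] with x hx
    obtain ⟨i, hi, hle⟩ := ciSup_eq_apply x
    rw [← hi, ← (hx i).1]
    refine le_antisymm (ciSup_le fun j => ?_)
      (le_ciSup (finite_range fun j => Q (x j)).bddAbove i)
    rw [(hx i).1, (hx j).1]
    gcongr
    exacts [(hx j).2, (hx i).2, fun s => signedStep_mono (hle j) _]
  rw [expectedMax, integral_congr_ae hsup, integral_add (integrable_const _) hI.integral_prod_left,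
    integral_integral_swap hI]
  simp_rw [integral_signedStep_iSup]
  simp

lemma expectedMax_sub_eq_integral (hθ : Measurable θ)
    (hint : Integrable (fun p : ℝ × S => signedStep a p.1 (θ p.2)) (τ.prod ρ))
    {Q : ℝ → ℝ} {c : ℝ} (hQ : ∀ᵐ z ∂τ, Q z = c + ∫ s, signedStep a z (θ s) ∂ρ)
    (k : ℕ) [NeZero k] :
    Integrable (fun s => τ.real (Iic (θ s)) - τ.real (Iic (θ s)) ^ k) ρ ∧
    expectedMax τ Q k - expectedMax τ Q 1 =
      ∫ s, (τ.real (Iic (θ s)) - τ.real (Iic (θ s)) ^ k) ∂ρ := by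
  obtain ⟨hk, hk'⟩ := expectedMax_eq_integral hθ hint hQ k
  obtain ⟨h1, h1'⟩ := expectedMax_eq_integral hθ hint hQ 1
  constructor
  · refine (hk.sub h1).congr (.of_forall fun s => ?_)
    simp
  · rw [hk', h1', add_sub_add_left_eq_sub, ← integral_sub hk h1]
    simp

end

/-- The maximum of copies of an almost surely constant random variable is that constant. -/
lemma expectedMax_of_ae_eq_const {Ω : Type*} [MeasurableSpace Ω] {P : Measure Ω}
    [IsProbabilityMeasure P] {X : Ω → ℝ} {c : ℝ} (hX : ∀ᵐ ω ∂P, X ω = c) (k : ℕ) [NeZero k] :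
    expectedMax P X k = c := by
  have h : ∀ᵐ x : Fin k → Ω ∂(Measure.pi fun _ => P), ∀ i, X (x i) = c :=
    ae_all_iff.2 fun i => (Measure.quasiMeasurePreserving_eval (fun _ : Fin k => P) i).ae hX
  have h' : ∀ᵐ x : Fin k → Ω ∂(Measure.pi fun _ => P), (⨆ i, X (x i)) = c := by
    filter_upwards [h] with x hx
    simp [hx]
  rw [expectedMax, integral_congr_ae h']
  simp

/-! ### Expected maxima and the distribution function -/

lemma signedStep_eq_indicator (a z : ℝ) :
    signedStep a z = (Ico a z).indicator 1 - (Ico z a).indicator 1 := by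
  ext t
  simp only [signedStep, Pi.sub_apply, indicator_apply, mem_Ico, Pi.one_apply]
  grind

lemma norm_signedStep_eq_indicator (a z t : ℝ) :
    ‖signedStep a z t‖ = (Ico a z).indicator 1 t + (Ico z a).indicator 1 t := by
  simp only [signedStep, indicator_apply, mem_Ico, Pi.one_apply]
  split_ifs <;> first | grind | norm_num

lemma integrable_indicator_Ico (a z : ℝ) : Integrable ((Ico a z).indicator (1 : ℝ → ℝ)) :=
  (integrable_indicator_iff measurableSet_Ico).2 (integrableOn_const (by simp))

lemma integral_signedStep (a z : ℝ) : ∫ t, signedStep a z t = z - a := by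
  rw [signedStep_eq_indicator]
  simp only [Pi.sub_apply]
  rw [integral_sub (integrable_indicator_Ico a z) (integrable_indicator_Ico z a),
    integral_indicator_one measurableSet_Ico, integral_indicator_one measurableSet_Ico,
    Real.volume_real_Ico, Real.volume_real_Ico]
  rcases le_total a z with h | h
  · rw [max_eq_left (by linarith), max_eq_right (by linarith)]; ring
  · rw [max_eq_right (by linarith), max_eq_left (by linarith)]; ring

lemma integral_norm_signedStep (a z : ℝ) : ∫ t, ‖signedStep a z t‖ = |z - a| := by
  simp_rw [norm_signedStep_eq_indicator]
  rw [integral_add (integrable_indicator_Ico a z) (integrable_indicator_Ico z a),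
    integral_indicator_one measurableSet_Ico, integral_indicator_one measurableSet_Ico,
    Real.volume_real_Ico, Real.volume_real_Ico]
  rcases le_total a z with h | h
  · rw [max_eq_left (by linarith), max_eq_right (by linarith), abs_of_nonneg (by linarith)]; ring
  · rw [max_eq_right (by linarith), max_eq_left (by linarith), abs_of_nonpos (by linarith)]; ring

/-- `E max(X₁, …, X_k) - E X = ∫ (F - Fᵏ)`, since `x = ∫ (1_{t < x} - 1_{t < 0}) dt`. -/
lemma expectedMax_sub_eq_integral_cdf {μ : Measure ℝ} [IsProbabilityMeasure μ]
    (hμ : Integrable id μ) (k : ℕ) [NeZero k] :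
    Integrable (fun t => cdf μ t - cdf μ t ^ k) ∧
    expectedMax μ id k - expectedMax μ id 1 = ∫ t, (cdf μ t - cdf μ t ^ k) := by
  simp_rw [cdf_eq_real]
  refine expectedMax_sub_eq_integral (ρ := volume) (θ := id) (a := 0) (c := 0) measurable_id ?_
    (.of_forall fun z => ?_) k
  · refine (integrable_prod_iff (measurable_signedStep measurable_fst
      measurable_snd).aestronglyMeasurable).2 ⟨.of_forall fun z => ?_, ?_⟩
    · change Integrable (signedStep 0 z)
      rw [signedStep_eq_indicator]
      exact (integrable_indicator_Ico 0 z).sub (integrable_indicator_Ico z 0)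
    · simp only [integral_norm_signedStep, sub_zero]
      exact hμ.abs
  · simp [integral_signedStep]

lemma mul_one_sub_cdf_nonneg (μ : Measure ℝ) (t : ℝ) : 0 ≤ cdf μ t * (1 - cdf μ t) :=
  mul_nonneg (cdf_nonneg μ t) (sub_nonneg.2 (cdf_le_one μ t))

lemma measurable_cdf (μ : Measure ℝ) : Measurable (cdf μ) := (monotone_cdf μ).measurable

/-- If `F (1 - F)` vanishes almost everywhere, then by right continuity `F` only takes the values
`0` and `1`, so that `F` belongs to a point mass. -/
lemma exists_ae_eq_const_of_cdf {μ : Measure ℝ} [IsProbabilityMeasure μ]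
    (h : ∀ᵐ t : ℝ, cdf μ t * (1 - cdf μ t) = 0) : ∃ c : ℝ, ∀ᵐ x ∂μ, x = c := by
  have h01 : ∀ t, cdf μ t = 0 ∨ cdf μ t = 1 := by
    intro t
    by_contra! ht
    have hcont : ContinuousWithinAt (fun t => cdf μ t * (1 - cdf μ t)) (Ici t) t :=
      ((cdf μ).right_continuous t).mul (continuousWithinAt_const.sub
        ((cdf μ).right_continuous t))
    have hne : cdf μ t * (1 - cdf μ t) ≠ 0 :=
      mul_ne_zero ht.1 (sub_ne_zero.2 ht.2.symm)
    obtain ⟨u, hu, hsub⟩ := (mem_nhdsGE_iff_exists_Ico_subset).1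
      (hcont.eventually_ne hne)
    have h0 : volume (Ico t u) = 0 := measure_mono_null hsub (ae_iff.1 h)
    rw [Real.volume_Ico, ENNReal.ofReal_eq_zero] at h0
    have : t < u := hu
    linarith
  have := HasCountableSeparatingOn.range_Iic (X := ℝ) (s := univ)
  refine exists_eventuallyEq_const_of_forall_separating (l := ae μ) (f := id)
    (· ∈ range (Iic : ℝ → Set ℝ)) ?_
  rintro _ ⟨t, rfl⟩
  have hF := ofReal_cdf μ t
  rcases h01 t with ht | ht
  · right
    rw [ht, ENNReal.ofReal_zero] at hF
    exact measure_eq_zero_iff_ae_notMem.1 hF.symm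
  · left
    rw [ht, ENNReal.ofReal_one] at hF
    exact mem_ae_iff.2 ((prob_compl_eq_zero_iff measurableSet_Iic).2 hF.symm)

/-! ### The law of `-log F(V)` -/

lemma ae_lawV_cdf_pos_lt_one {μ : Measure ℝ} (lam : ℝ) :
    ∀ᵐ t ∂(lawV (cdf μ) lam), 0 < cdf μ t ∧ cdf μ t < 1 := by
  refine (ae_withDensity_iff ?_).2 (.of_forall fun t ht => ?_)
  · have := measurable_cdf μ
    fun_prop
  · have hne : cdf μ t * (1 - cdf μ t) ≠ 0 := fun h => ht (by simp [h])
    have h := mul_ne_zero_iff.1 hne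
    exact ⟨(cdf_nonneg μ t).lt_of_ne h.1.symm,
      (cdf_le_one μ t).lt_of_ne fun h1 => h.2 (by rw [h1, sub_self])⟩

/-- The integrand `λ eʸ / (1 - e⁻ʸ) (m₁ / λ e⁻ʸ (1 - e⁻ʸ) + e⁻ʸ - e⁻ˣʸ)` of the representation of
`g` as an integral over the law of `-log F(V)`. -/
noncomputable def maximaKernel (m₁ lam x y : ℝ) : ℝ :=
  lam * Real.exp y / (1 - Real.exp (-y)) *
    (m₁ / lam * Real.exp (-y) * (1 - Real.exp (-y)) + Real.exp (-y) - Real.exp (-(x * y)))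

lemma maximaKernel_eq {m₁ lam : ℝ} (hlam : lam ≠ 0) (x : ℝ) {y : ℝ} (hy : 0 < y) :
    maximaKernel m₁ lam x y =
      m₁ + lam * ((1 - Real.exp (-((x - 1) * y))) / (1 - Real.exp (-y))) := by
  have h0 := (one_sub_exp_neg_pos hy).ne'
  have h1 := Real.exp_ne_zero y
  have h2 : Real.exp (-(x * y)) = Real.exp (-y) * Real.exp (-((x - 1) * y)) := by
    rw [← Real.exp_add]; ring_nf
  rw [maximaKernel, h2]
  generalize Real.exp (-((x - 1) * y)) = E
  have h3 : Real.exp y * Real.exp (-y) = 1 := by rw [← Real.exp_add]; simp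
  field_simp
  linear_combination (m₁ * (1 - Real.exp (-y)) +
    lam * (1 - E)) * h3

lemma measurable_maximaKernel (m₁ lam x : ℝ) : Measurable (maximaKernel m₁ lam x) := by
  unfold maximaKernel
  fun_prop

lemma integrableOn_maximaKernel {η : Measure ℝ} [IsFiniteMeasure η] (m₁ : ℝ) {lam : ℝ}
    (hlam : 0 < lam) {x : ℝ} (hx : 1 ≤ x) : IntegrableOn (maximaKernel m₁ lam x) (Ioi 0) η := by
  refine Integrable.mono' (integrable_const (|m₁| + lam * (x * 2)))
    (measurable_maximaKernel _ _ _).aestronglyMeasurable ?_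
  filter_upwards [ae_restrict_mem measurableSet_Ioi] with y (hy : 0 < y)
  have h0 := one_sub_exp_neg_pos hy
  rw [maximaKernel_eq hlam.ne' x hy, Real.norm_eq_abs]
  refine (abs_add_le _ _).trans ?_
  gcongr
  rw [abs_mul, abs_of_pos hlam, abs_of_nonneg
    (div_nonneg (one_sub_exp_neg_nonneg (by linarith) hy) h0.le)]
  gcongr
  rw [div_le_iff₀ h0]
  have h1 := one_sub_exp_neg_le (x := x - 1) (by linarith) hy
  have h2 := min_one_le_mul_one_sub_exp hy
  nlinarith

/-- The law of `-log F(V)`, where `V` has density `F (1 - F) / λ`. -/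
noncomputable def lawNegLogCdf (μ : Measure ℝ) (lam : ℝ) : Measure ℝ :=
  (lawV (cdf μ) lam).map fun t => -Real.log (cdf μ t)

lemma measurable_neg_log_cdf (μ : Measure ℝ) : Measurable fun t => -Real.log (cdf μ t) :=
  (Real.measurable_log.comp (measurable_cdf μ)).neg

lemma ae_lawNegLogCdf_pos (μ : Measure ℝ) (lam : ℝ) : ∀ᵐ y ∂(lawNegLogCdf μ lam), 0 < y := by
  refine (ae_map_iff (measurable_neg_log_cdf μ).aemeasurable measurableSet_Ioi).2 ?_
  filter_upwards [ae_lawV_cdf_pos_lt_one lam] with t ht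
  simpa using Real.log_neg ht.1 ht.2

lemma isProbabilityMeasure_lawV {μ : Measure ℝ} {lam : ℝ} (hlam : 0 < lam)
    (hint : Integrable fun t => cdf μ t * (1 - cdf μ t))
    (heq : ∫ t, cdf μ t * (1 - cdf μ t) = lam) : IsProbabilityMeasure (lawV (cdf μ) lam) := by
  constructor
  rw [lawV, withDensity_apply _ .univ, setLIntegral_univ, ← ofReal_integral_eq_lintegral_ofReal
    (hint.const_mul _) (.of_forall fun t => mul_nonneg (by positivity) (mul_one_sub_cdf_nonneg μ t)),
    integral_const_mul, heq, one_div_mul_cancel hlam.ne', ENNReal.ofReal_one]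

lemma integral_maximaKernel_lawNegLogCdf {μ : Measure ℝ} {lam : ℝ} (hlam : 0 < lam)
    [IsProbabilityMeasure (lawV (cdf μ) lam)] (m₁ : ℝ) (k : ℕ) :
    ∫ y in Ioi 0, maximaKernel m₁ lam (k + 1 : ℕ) y ∂(lawNegLogCdf μ lam) =
      m₁ + ∫ t, (cdf μ t - cdf μ t ^ (k + 1)) := by
  have hres : (lawNegLogCdf μ lam).restrict (Ioi 0) = lawNegLogCdf μ lam :=
    Measure.restrict_eq_self_of_ae_mem (ae_lawNegLogCdf_pos μ lam)
  have : IsProbabilityMeasure (lawNegLogCdf μ lam) :=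
    Measure.isProbabilityMeasure_map (measurable_neg_log_cdf μ).aemeasurable
  have hI := integrableOn_maximaKernel (η := lawNegLogCdf μ lam) m₁ hlam
    (x := (k + 1 : ℕ)) (by simp)
  rw [IntegrableOn, hres] at hI
  have hI' := (integrable_map_measure hI.aestronglyMeasurable
    (measurable_neg_log_cdf μ).aemeasurable).1 hI
  rw [hres, lawNegLogCdf, integral_map (measurable_neg_log_cdf μ).aemeasurable
    (measurable_maximaKernel _ _ _).aestronglyMeasurable]
  have hker : ∀ᵐ t ∂(lawV (cdf μ) lam),
      maximaKernel m₁ lam (k + 1 : ℕ) (-Real.log (cdf μ t)) =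
        m₁ + lam * ((1 - cdf μ t ^ k) / (1 - cdf μ t)) := by
    filter_upwards [ae_lawV_cdf_pos_lt_one lam] with t ht
    rw [maximaKernel_eq hlam.ne' _ (by simpa using Real.log_neg ht.1 ht.2)]
    simp only [Nat.cast_add, Nat.cast_one, add_sub_cancel_right, neg_neg, Real.exp_log ht.1,
      mul_neg, Real.exp_nat_mul]
  have hI'' : Integrable (fun t => lam * ((1 - cdf μ t ^ k) / (1 - cdf μ t)))
      (lawV (cdf μ) lam) := by
    refine (hI'.sub (integrable_const m₁)).congr ?_
    filter_upwards [hker] with t ht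
    simp only [Pi.sub_apply, Function.comp_apply, ht]
    ring
  rw [integral_congr_ae hker, integral_add (integrable_const _) hI'', integral_const,
    probReal_univ, one_smul, lawV, integral_withDensity_eq_integral_toReal_smul]
  · congr 2 with t
    rw [ENNReal.toReal_ofReal (mul_nonneg (by positivity) (mul_one_sub_cdf_nonneg μ t)),
      smul_eq_mul]
    rcases eq_or_ne (1 - cdf μ t) 0 with h | h
    · rw [h, show cdf μ t = 1 by linarith]; simp
    · field_simp
      ring
  · have := measurable_cdf μ
    fun_prop
  · simp

/-- For `X` with law `μ` the integral representation over the law of `-log F(V)` reproduces the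
expected maxima. -/
lemma HasExpectedMaxima.representation {Ω : Type*} [MeasurableSpace Ω] {P : Measure Ω}
    [IsProbabilityMeasure P] {X : Ω → ℝ} {m : ℕ → ℝ} (h : HasExpectedMaxima P X m) :
    0 < m 2 - m 1 ∧ IsProbabilityMeasure (lawV (cdf (P.map X)) (m 2 - m 1)) ∧
    ∀ k : ℕ, 1 ≤ k → m k = ∫ y in Ioi 0, maximaKernel (m 1) (m 2 - m 1) k y
      ∂(lawNegLogCdf (P.map X) (m 2 - m 1)) := by
  have hX : AEMeasurable X P := h.integrable.aemeasurable
  have : IsProbabilityMeasure (P.map X) := Measure.isProbabilityMeasure_map hX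
  set μ := P.map X with hμ
  have hid : Integrable id μ := (integrable_map_measure (by fun_prop) hX).2 h.integrable
  have hm : ∀ (k : ℕ) [NeZero k], Integrable (fun t => cdf μ t - cdf μ t ^ k) ∧
      m k - m 1 = ∫ t, (cdf μ t - cdf μ t ^ k) := fun k _ => by
    rw [← h.expectedMax_eq k (Nat.pos_of_neZero k), ← h.expectedMax_eq 1 le_rfl,
      expectedMax_eq_map P hX, expectedMax_eq_map P hX]
    exact expectedMax_sub_eq_integral_cdf hid k
  have hsq : (fun t => cdf μ t - cdf μ t ^ 2) = fun t => cdf μ t * (1 - cdf μ t) := by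
    ext t; ring
  obtain ⟨hint, heq⟩ := hm 2
  rw [hsq] at hint heq
  have hpos : 0 < m 2 - m 1 := by
    refine lt_of_le_of_ne (heq ▸ integral_nonneg fun t => mul_one_sub_cdf_nonneg μ t) fun h0 => ?_
    rw [heq, eq_comm, integral_eq_zero_iff_of_nonneg (fun t => mul_one_sub_cdf_nonneg μ t) hint]
      at h0
    obtain ⟨c, hc⟩ := exists_ae_eq_const_of_cdf h0
    exact h.nondegenerate ⟨c, ae_of_ae_map hX hc⟩
  have hprob := isProbabilityMeasure_lawV hpos hint heq.symm
  refine ⟨hpos, hprob, fun k hk => ?_⟩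
  obtain ⟨k, rfl⟩ := Nat.exists_eq_add_of_le' hk
  rw [integral_maximaKernel_lawNegLogCdf hpos, ← (hm (k + 1)).2]
  ring

/-- The integral representation over the law of `-log F(V)` is a generalized integral form. -/
lemma gStar_integral_maximaKernel {η : Measure ℝ} [IsFiniteMeasure η] (hη : η (Iic 0) = 0)
    (m₁ : ℝ) {lam : ℝ} (hlam : 0 < lam) {m : ℕ → ℝ} (hm : m 1 ≠ m 2)
    (heq : ∀ k : ℕ, 1 ≤ k → m k = ∫ y in Ioi 0, maximaKernel m₁ lam k y ∂η) :
    GStar fun x => ∫ y in Ioi 0, maximaKernel m₁ lam x y ∂η := by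
  refine ⟨⟨η, fun y => lam * Real.exp y / (1 - Real.exp (-y)),
    fun y => m₁ / lam * Real.exp (-y) * (1 - Real.exp (-y)) + Real.exp (-y),
    inferInstance, hη, by fun_prop, by fun_prop, fun y hy => ?_, ?_, fun x hx => ?_⟩, ?_⟩
  · have := one_sub_exp_neg_pos hy
    positivity
  · refine (integrable_const lam).congr ?_
    filter_upwards [ae_restrict_mem measurableSet_Ioi] with y hy
    have h0 := (one_sub_exp_neg_pos hy).ne'
    have h3 : Real.exp y * Real.exp (-y) = 1 := by rw [← Real.exp_add]; simp
    field_simp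
    linear_combination -h3
  · exact ⟨integrableOn_maximaKernel m₁ hlam hx, rfl⟩
  · rintro ⟨c, hc⟩
    refine hm ?_
    rw [heq 1 le_rfl, heq 2 one_le_two]
    exact (hc _ (by simp)).trans (hc _ (by simp)).symm

/-! ### From Bernstein functions to random variables -/

/-- The uniform distribution on `(0, 1)`. -/
noncomputable def uniformUnit : Measure ℝ := volume.restrict (Ioo 0 1)

instance : IsProbabilityMeasure uniformUnit := ⟨by simp [uniformUnit]⟩

lemma uniformUnit_real_Iic {t : ℝ} (h0 : 0 ≤ t) (h1 : t < 1) : uniformUnit.real (Iic t) = t := by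
  have : Iic t ∩ Ioo 0 1 = Ioc 0 t := by
    ext z
    simp only [mem_inter_iff, mem_Iic, mem_Ioo, mem_Ioc]
    constructor
    · rintro ⟨h, h', -⟩
      exact ⟨h', h⟩
    · rintro ⟨h, h'⟩
      exact ⟨h', h, by linarith⟩
  rw [uniformUnit, measureReal_restrict_apply measurableSet_Iic, this, Real.volume_real_Ioc_of_le h0,
    sub_zero]

lemma integral_norm_signedStep_uniformUnit {t : ℝ} (h0 : 0 ≤ t) (h1 : t < 1) :
    ∫ z, ‖signedStep (1 / 2) z t‖ ∂uniformUnit ≤ 2 * (t * (1 - t)) := by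
  rcases lt_or_ge t (1 / 2) with h | h
  · have : ∀ z, ‖signedStep (1 / 2) z t‖ = (Iic t).indicator 1 z := fun z => by
      simp only [signedStep, h, if_true, indicator_apply, mem_Iic, Pi.one_apply]
      split_ifs <;> first | grind | norm_num
    simp_rw [this]
    rw [integral_indicator_one measurableSet_Iic, uniformUnit_real_Iic h0 h1]
    nlinarith
  · have : ∀ z, ‖signedStep (1 / 2) z t‖ = (Iic t)ᶜ.indicator 1 z := fun z => by
      simp only [signedStep, not_lt.2 h, if_false, indicator_apply, mem_compl_iff, mem_Iic,
        Pi.one_apply]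
      split_ifs <;> first | grind | norm_num
    simp_rw [this]
    rw [integral_indicator_one measurableSet_Iic.compl, probReal_compl_eq_one_sub measurableSet_Iic,
      uniformUnit_real_Iic h0 h1]
    nlinarith

lemma sFinite_restrict_of_integrableOn_min {ν : Measure ℝ}
    (hν : IntegrableOn (fun y : ℝ => min 1 y) (Ioi 0) ν) : SFinite (ν.restrict (Ioi 0)) := by
  set f : ℝ → ℝ≥0∞ := fun y => ENNReal.ofReal (min 1 y) with hf
  have hfm : Measurable f := by fun_prop
  have : IsFiniteMeasure ((ν.restrict (Ioi 0)).withDensity f) :=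
    isFiniteMeasure_withDensity ((integrableOn_min_iff ν).1 hν).ne
  have h := withDensity_inv_same (μ := ν.restrict (Ioi 0)) hfm
    (by
      filter_upwards [ae_restrict_mem measurableSet_Ioi] with y (hy : 0 < y)
      simpa [hf] using hy)
    (.of_forall fun y => ENNReal.ofReal_ne_top)
  rw [← h]
  infer_instance

/-- The image of the measure `eʸ dν(y)` under `y ↦ e⁻ʸ` is the measure `dQ` of a quantile function
`Q`; it satisfies the integrability condition `∫ u (1 - u) dQ(u) < ∞`. -/
lemma integrable_signedStep_exp_neg {ν : Measure ℝ}
    (hν : IntegrableOn (fun y : ℝ => min 1 y) (Ioi 0) ν) [SFinite (ν.restrict (Ioi 0))] :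
    Integrable (fun p : ℝ × ℝ => signedStep (1 / 2) p.1 (Real.exp (-p.2)))
      (uniformUnit.prod
        ((ν.restrict (Ioi 0)).withDensity fun y => ENNReal.ofReal (Real.exp y))) := by
  set ρ := (ν.restrict (Ioi 0)).withDensity fun y => ENNReal.ofReal (Real.exp y) with hρ
  have hmeas : Measurable fun p : ℝ × ℝ => signedStep (1 / 2) p.1 (Real.exp (-p.2)) :=
    measurable_signedStep measurable_fst (by fun_prop)
  have hpos : ∀ᵐ y ∂ρ, 0 < y :=
    (withDensity_absolutelyContinuous _ _).ae_le (ae_restrict_mem measurableSet_Ioi)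
  refine (integrable_prod_iff' hmeas.aestronglyMeasurable).2 ⟨.of_forall fun y => ?_, ?_⟩
  · refine (integrable_const (2 : ℝ)).mono'
      (hmeas.comp (by fun_prop : Measurable fun z : ℝ => (z, y))).aestronglyMeasurable
      (.of_forall fun z => ?_)
    simp only [signedStep]
    split_ifs <;> norm_num
  · have hI : Integrable (fun y => 2 * (Real.exp (-y) * (1 - Real.exp (-y)))) ρ := by
      rw [hρ, integrable_withDensity_iff_integrable_smul' (by fun_prop) (by simp)]
      refine ((integrableOn_one_sub_exp hν zero_le_one).const_mul 2).congr (.of_forall fun y => ?_)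
      have h3 : Real.exp y * Real.exp (-y) = 1 := by rw [← Real.exp_add]; simp
      simp only [ENNReal.toReal_ofReal (Real.exp_pos y).le, smul_eq_mul, one_mul]
      linear_combination (-2 * (1 - Real.exp (-y))) * h3
    refine hI.mono' ?_ ?_
    · exact (hmeas.norm.stronglyMeasurable.integral_prod_left').aestronglyMeasurable
    · filter_upwards [hpos] with y hy
      rw [Real.norm_of_nonneg (integral_nonneg fun _ => norm_nonneg _)]
      exact integral_norm_signedStep_uniformUnit (Real.exp_pos _).le (by simpa using hy)

/-- Every Laplace exponent of a nonzero Lévy measure belongs to a sequence of expected maxima: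
`X = Q(U)` with `U` uniform on `(0, 1)` and the quantile function
`Q u = c + ∫ (1_{v < u} - 1_{v < 1/2}) dρ(v)`, `v = e⁻ʸ`, `dρ = eʸ dν(y)`, does it. -/
lemma isExpectedMaximaSeq_of_laplaceExponent {ν : Measure ℝ} (h0 : ν ≠ 0) (hI : ν (Iic 0) = 0)
    (hν : IntegrableOn (fun y : ℝ => min 1 y) (Ioi 0) ν) {m : ℕ → ℝ}
    (hm : ∀ k : ℕ, 1 ≤ k → m k = m 1 + laplaceExponent ν ((k : ℝ) - 1)) :
    IsExpectedMaximaSeq.{u} m := by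
  have := sFinite_restrict_of_integrableOn_min hν
  have hint := integrable_signedStep_exp_neg hν
  set ρ := (ν.restrict (Ioi 0)).withDensity fun y => ENNReal.ofReal (Real.exp y) with hρ
  have hθ : Measurable fun y : ℝ => Real.exp (-y) := by fun_prop
  have hpos : ∀ᵐ y ∂ρ, 0 < y :=
    (withDensity_absolutelyContinuous _ _).ae_le (ae_restrict_mem measurableSet_Ioi)
  set c := m 1 - ∫ y, ((if Real.exp (-y) < 1 / 2 then 0 else 1) -
    uniformUnit.real (Iic (Real.exp (-y))) ^ 1) ∂ρ with hc
  set Q : ℝ → ℝ := fun z => c + ∫ y, signedStep (1 / 2) z (Real.exp (-y)) ∂ρ with hQ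
  have hQint : Integrable Q uniformUnit := (integrable_const c).add hint.integral_prod_left
  have hmax1 : expectedMax uniformUnit Q 1 = m 1 := by
    rw [(expectedMax_eq_integral hθ hint (Q := Q) (.of_forall fun z => rfl) 1).2, hc]
    ring
  have hmax : ∀ k : ℕ, 1 ≤ k → expectedMax uniformUnit Q k = m k := by
    intro k hk
    have : NeZero k := ⟨by omega⟩
    have h := (expectedMax_sub_eq_integral hθ hint (Q := Q) (.of_forall fun z => rfl) k).2
    rw [hmax1, sub_eq_iff_eq_add'] at h
    rw [h, hm k hk, laplaceExponent]
    congr 1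
    have hae : ∀ᵐ y ∂ρ, uniformUnit.real (Iic (Real.exp (-y))) -
        uniformUnit.real (Iic (Real.exp (-y))) ^ k = Real.exp (-y) - Real.exp (-y) ^ k := by
      filter_upwards [hpos] with y hy
      rw [uniformUnit_real_Iic (Real.exp_pos _).le (by simpa using hy)]
    rw [integral_congr_ae hae, hρ,
      integral_withDensity_eq_integral_toReal_smul (by fun_prop) (by simp)]
    congr 1 with y
    rw [ENNReal.toReal_ofReal (Real.exp_pos y).le, smul_eq_mul, mul_sub, ← Real.exp_nat_mul,
      ← Real.exp_add, ← Real.exp_add, add_neg_cancel, Real.exp_zero]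
    ring_nf
  have hmap : (uniformUnit.map (ULift.up.{u})).map (Q ∘ ULift.down) = uniformUnit.map Q := by
    rw [AEMeasurable.map_map_of_aemeasurable _ measurable_up.aemeasurable]
    · rfl
    · refine AEMeasurable.comp_measurable ?_ measurable_down
      rw [Measure.map_map measurable_down measurable_up]
      simpa [Function.comp_def] using hQint.aemeasurable
  have hX : Integrable (Q ∘ ULift.down) (uniformUnit.map (ULift.up.{u})) := by
    refine (integrable_map_measure ?_ measurable_up.aemeasurable).2 hQint
    refine AEStronglyMeasurable.comp_measurable ?_ measurable_down
    rw [Measure.map_map measurable_down measurable_up]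
    simpa [Function.comp_def] using hQint.aestronglyMeasurable
  have hprob : IsProbabilityMeasure (uniformUnit.map (ULift.up.{u})) :=
    Measure.isProbabilityMeasure_map measurable_up.aemeasurable
  have hX' : ∀ k : ℕ, 1 ≤ k →
      expectedMax (uniformUnit.map (ULift.up.{u})) (Q ∘ ULift.down) k = m k := fun k hk => by
    rw [expectedMax_eq_map _ hX.aemeasurable, hmap, ← expectedMax_eq_map _ hQint.aemeasurable,
      hmax k hk]
  refine ⟨ULift.{u} ℝ, inferInstance, uniformUnit.map ULift.up, hprob, Q ∘ ULift.down,
    hX, ?_, hX'⟩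
  rintro ⟨d, hd⟩
  -- for a constant `X` the first two expected maxima coincide
  have h1 := hX' 1 le_rfl
  have h2 := hX' 2 one_le_two
  rw [expectedMax_of_ae_eq_const hd] at h1 h2
  have h3 := hm 2 one_le_two
  have h4 := laplaceExponent_one_pos h0 hI hν
  norm_num at h3
  linarith

/-! ### From generalized integral forms to Bernstein functions -/

/-- If `g x = ∫ h y (s y - e⁻ˣʸ) dμ(y)`, then `g (x + 1) - g 1` is the Laplace exponent of the
measure `h y e⁻ʸ dμ(y)`. -/
lemma GStar.bStar {g : ℝ → ℝ} (hg : GStar g) : BStar fun x => g (x + 1) - g 1 := by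
  obtain ⟨⟨μ, h, s, _, hμ, hh, -, hpos, hint, hrep⟩, hconst⟩ := hg
  set w : ℝ → ℝ≥0∞ := fun y => ENNReal.ofReal (h y * Real.exp (-y)) with hw
  have hwm : Measurable w := by fun_prop
  have hwr : ∀ y, 0 < y → (w y).toReal = h y * Real.exp (-y) := fun y hy =>
    ENNReal.toReal_ofReal (mul_nonneg (hpos y hy) (Real.exp_pos _).le)
  have hres : (μ.withDensity w).restrict (Ioi 0) = (μ.restrict (Ioi 0)).withDensity w :=
    restrict_withDensity measurableSet_Ioi w
  have heq : EqOn (fun x => g (x + 1) - g 1) (laplaceExponent (μ.withDensity w)) (Ici 0) := by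
    intro x (hx : 0 ≤ x)
    obtain ⟨h1, h1'⟩ := hrep 1 le_rfl
    obtain ⟨hx, hx'⟩ := hrep (x + 1) (by linarith)
    rw [laplaceExponent, hres, integral_withDensity_eq_integral_toReal_smul hwm (by simp [hw])]
    simp only
    rw [h1', hx', ← integral_sub hx h1]
    refine setIntegral_congr_fun measurableSet_Ioi fun y hy => ?_
    simp only [hwr y hy, smul_eq_mul]
    rw [show -((x + 1) * y) = -y + -(x * y) by ring, Real.exp_add, one_mul]
    ring
  have hν : IntegrableOn (fun y : ℝ => min 1 y) (Ioi 0) (μ.withDensity w) := by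
    rw [IntegrableOn, hres, integrable_withDensity_iff_integrable_smul' hwm (by simp [hw])]
    refine (hint.const_mul 2).mono' (by fun_prop) ?_
    filter_upwards [ae_restrict_mem measurableSet_Ioi] with y (hy : 0 < y)
    have := min_one_le_mul_one_sub_exp hy
    have hw0 := mul_nonneg (hpos y hy) (Real.exp_pos (-y)).le
    rw [hwr y hy, smul_eq_mul, norm_mul, Real.norm_of_nonneg hw0,
      Real.norm_of_nonneg (le_min zero_le_one hy.le)]
    nlinarith
  refine bStar_iff.2 ⟨μ.withDensity w, fun h0 => hconst ⟨g 1, fun x hx => ?_⟩,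
    withDensity_absolutelyContinuous _ _ hμ, hν, heq⟩
  have := heq (x := x - 1) (by simpa using hx)
  simpa [h0, laplaceExponent, sub_eq_zero] using this

/-! ### The equivalence and the representation -/

/-- The generalized integral form over the law of `-log F(V)` for a random variable with the given
expected maxima. -/
lemma HasExpectedMaxima.gStar {Ω : Type*} [MeasurableSpace Ω] {P : Measure Ω}
    [IsProbabilityMeasure P] {X : Ω → ℝ} {m : ℕ → ℝ} (h : HasExpectedMaxima P X m) :
    GStar (fun x => ∫ y in Ioi 0, maximaKernel (m 1) (m 2 - m 1) x y
      ∂(lawNegLogCdf (P.map X) (m 2 - m 1))) := by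
  obtain ⟨hpos, hprob, hm⟩ := h.representation
  have : IsProbabilityMeasure (lawNegLogCdf (P.map X) (m 2 - m 1)) :=
    Measure.isProbabilityMeasure_map (measurable_neg_log_cdf _).aemeasurable
  refine gStar_integral_maximaKernel ?_ _ hpos (by linarith) hm
  simpa [ae_iff, Iic_def] using ae_lawNegLogCdf_pos (P.map X) (m 2 - m 1)

/-- Functions of class `𝒢*` are determined by their values at the positive integers. -/
lemma GStar.eqOn {g g' : ℝ → ℝ} (hg : GStar g) (hg' : GStar g')
    (h : ∀ k : ℕ, 1 ≤ k → g k = g' k) : EqOn g g' (Ici 1) := by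
  have h1 : g 1 = g' 1 := by simpa using h 1 le_rfl
  have hB := hg.bStar.eqOn hg'.bStar fun n => by
    have := h (n + 1) (by omega)
    push_cast at this
    simp only [this, h1]
  intro x (hx : 1 ≤ x)
  have := hB (x := x - 1) (by simpa using hx)
  simpa [h1] using this

theorem theorem3p1 (m : ℕ → ℝ) :
    -- the equivalence of (i), (ii), (iii)
    List.TFAE
      [IsExpectedMaximaSeq.{u} m,
        ∃ g : ℝ → ℝ, GStar g ∧ ∀ k : ℕ, 1 ≤ k → m k = g k,
        ∃ B : ℝ → ℝ, BStar B ∧ ∀ k : ℕ, 1 ≤ k → m k = m 1 + B ((k : ℝ) - 1)] ∧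
    -- uniqueness and representation, if one of (i), (ii), (iii) holds
    ((IsExpectedMaximaSeq.{u} m ∨
        (∃ g : ℝ → ℝ, GStar g ∧ ∀ k : ℕ, 1 ≤ k → m k = g k) ∨
        (∃ B : ℝ → ℝ, BStar B ∧ ∀ k : ℕ, 1 ≤ k → m k = m 1 + B ((k : ℝ) - 1))) →
      ∃ g B : ℝ → ℝ,
        -- existence and uniqueness of `g` on `[1, ∞)`
        (GStar g ∧ ∀ k : ℕ, 1 ≤ k → m k = g k) ∧
        (∀ g' : ℝ → ℝ, GStar g' → (∀ k : ℕ, 1 ≤ k → m k = g' k) → Set.EqOn g' g (Set.Ici 1)) ∧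
        -- existence and uniqueness of `B` on `[0, ∞)`
        (BStar B ∧ ∀ k : ℕ, 1 ≤ k → m k = m 1 + B ((k : ℝ) - 1)) ∧
        (∀ B' : ℝ → ℝ, BStar B' → (∀ k : ℕ, 1 ≤ k → m k = m 1 + B' ((k : ℝ) - 1)) →
          Set.EqOn B' B (Set.Ici 0)) ∧
        -- the relation between `g` and `B`
        (∀ x : ℝ, 0 ≤ x → B x = g (x + 1) - m 1) ∧
        -- the representation of `g`, for every `X` as in (i)
        (∀ (Ω : Type u) [MeasurableSpace Ω] (P : Measure Ω) [IsProbabilityMeasure P] (X : Ω → ℝ),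
          HasExpectedMaxima P X m →
          0 < m 2 - m 1 ∧
          IsProbabilityMeasure (lawV (cdf (P.map X)) (m 2 - m 1)) ∧
          ∀ (Ω' : Type v) [MeasurableSpace Ω'] (P' : Measure Ω') [IsProbabilityMeasure P']
            (V Y : Ω' → ℝ),
            HasLaw V (lawV (cdf (P.map X)) (m 2 - m 1)) P' →
            (∀ ω, Y ω = -Real.log (cdf (P.map X) (V ω))) →
            (∀ᵐ ω ∂P', 0 < Y ω) ∧
            ∀ x : ℝ, 1 ≤ x →
              IntegrableOn (fun y => (m 2 - m 1) * Real.exp y / (1 - Real.exp (-y)) *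
                (m 1 / (m 2 - m 1) * Real.exp (-y) * (1 - Real.exp (-y)) +
                  Real.exp (-y) - Real.exp (-(x * y)))) (Set.Ioi 0) (P'.map Y) ∧
              g x = ∫ y in Set.Ioi 0, (m 2 - m 1) * Real.exp y / (1 - Real.exp (-y)) *
                (m 1 / (m 2 - m 1) * Real.exp (-y) * (1 - Real.exp (-y)) +
                  Real.exp (-y) - Real.exp (-(x * y))) ∂(P'.map Y))) := by
  have h12 : IsExpectedMaximaSeq.{u} m → ∃ g : ℝ → ℝ, GStar g ∧ ∀ k : ℕ, 1 ≤ k → m k = g k := by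
    rintro ⟨Ω, _, P, _, X, h⟩
    exact ⟨_, h.gStar, h.representation.2.2⟩
  have h23 : (∃ g : ℝ → ℝ, GStar g ∧ ∀ k : ℕ, 1 ≤ k → m k = g k) →
      ∃ B : ℝ → ℝ, BStar B ∧ ∀ k : ℕ, 1 ≤ k → m k = m 1 + B ((k : ℝ) - 1) := by
    rintro ⟨g, hg, hm⟩
    refine ⟨_, hg.bStar, fun k hk => ?_⟩
    simp [hm k hk, hm 1 le_rfl]
  have h31 : (∃ B : ℝ → ℝ, BStar B ∧ ∀ k : ℕ, 1 ≤ k → m k = m 1 + B ((k : ℝ) - 1)) →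
      IsExpectedMaximaSeq.{u} m := by
    rintro ⟨B, hB, hm⟩
    obtain ⟨ν, h0, hI, hν, hBν⟩ := bStar_iff.1 hB
    refine isExpectedMaximaSeq_of_laplaceExponent h0 hI hν fun k hk => ?_
    rw [hm k hk, hBν]
    simpa using hk
  refine ⟨?_, fun h => ?_⟩
  · tfae_have 1 → 2 := h12
    tfae_have 2 → 3 := h23
    tfae_have 3 → 1 := h31
    tfae_finish
  have h2 : ∃ g : ℝ → ℝ, GStar g ∧ ∀ k : ℕ, 1 ≤ k → m k = g k := by
    rcases h with h | h | h
    exacts [h12 h, h, h12 (h31 h)]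
  obtain ⟨g, hg, hm⟩ := h2
  have hm1 : m 1 = g 1 := by simpa using hm 1 le_rfl
  have hgB : ∀ k : ℕ, 1 ≤ k → m k = m 1 + (g ((k : ℝ) - 1 + 1) - g 1) := fun k hk => by
    simp [hm k hk, hm1]
  refine ⟨g, fun x => g (x + 1) - g 1, ⟨hg, hm⟩, fun g' hg' hm' => ?_, ⟨hg.bStar, hgB⟩,
    fun B' hB' hm' => ?_, fun x _ => by rw [hm1], ?_⟩
  · exact hg'.eqOn hg fun k hk => by rw [← hm k hk, hm' k hk]
  · refine hB'.eqOn hg.bStar fun n => ?_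
    have h1 := hm' (n + 1) (by omega)
    rw [hgB (n + 1) (by omega)] at h1
    push_cast at h1
    simpa using h1.symm
  · intro Ω _ P _ X hX
    obtain ⟨hpos, hprob, hrep⟩ := hX.representation
    refine ⟨hpos, hprob, fun Ω' _ P' _ V Y hV hY => ?_⟩
    have hlaw : P'.map Y = lawNegLogCdf (P.map X) (m 2 - m 1) := by
      rw [funext hY, lawNegLogCdf, ← hV.map_eq, AEMeasurable.map_map_of_aemeasurable
        (measurable_neg_log_cdf _).aemeasurable hV.aemeasurable]
      rfl
    have hYm : AEMeasurable Y P' := by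
      rw [funext hY]
      exact (measurable_neg_log_cdf _).comp_aemeasurable hV.aemeasurable
    refine ⟨ae_of_ae_map hYm (hlaw ▸ ae_lawNegLogCdf_pos _ _), fun x hx => ?_⟩
    have : IsProbabilityMeasure (P'.map Y) := Measure.isProbabilityMeasure_map hYm
    refine ⟨integrableOn_maximaKernel (m 1) hpos hx, ?_⟩
    rw [hlaw]
    exact hg.eqOn hX.gStar (fun k hk => by rw [← hm k hk, hrep k hk]) hx
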